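/- Let $d,r\ge 1$ be integers. On $\ell^2(\mathbb Z^d)$ let $(H_0f)(n)=2d\,f(n)-\sum_{|k-n|=1}f(k)$, and for $k\in r\mathbb Z^d$ let $P_k$ be the operator of multiplication by the characteristic function of the cube $\Lambda_r(k)=\prod_{j=1}^d\{k_j,\dots,k_j+r-1\}$ (a projection of rank $r^d$). Let $(\omega_k)_{k\in r\mathbb Z^d}$ be independent, identically distributed random variables with values in $[0,1]$, whose common law has a density $\rho$ on $[0,1]$ such that, for some constants $\mathcal K$ and $\rho_-,\rho_+\in(0,\infty)$, $|\rho(x)-\rho(y)|\le\mathcal K|x-y|$ and $\rho_-<\rho(x)<\rho_+$ for all $x,y\in[0,1]$. Let $$H_\omega=H_0+\sum_{k\in r\mathbb Z^d}\omega_kP_k$$ be the higher-rank Anderson operator. For $E>0$ put $I_E=[0,E]\cup[4d+1-E,\,4d+1]$, and let $\gamma_{\infty,r}=1-\cos(\pi/r)$. Let $E_{\rm loc}>0$ be such that, almost surely, the spectrum of $H_\omega$ in $I_{E_{\rm loc}}$ is pure point and every eigenfunction $\varphi$ of $H_\omega$ with eigenvalue in $I_{E_{\rm loc}}$ decays exponentially,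 that is, $|\varphi(n)|\le Ce^{-c|n|}$ for all $n\in\mathbb Z^d$, with constants $C,c>0$ that may depend on $\omega$ and $\varphi$. Then, for every $E_0$ with $0<E_0<\min(\gamma_{\infty,r},E_{\rm loc})$, almost surely every eigenvalue of $H_\omega$ in $I_{E_0}$ is simple. -/

import Mathlib

open MeasureTheory ProbabilityTheory

noncomputable section

namespace HigherRankAnderson

/-- The lattice `ℤ^d`. -/
abbrev Site (d : ℕ) : Type := Fin d → ℤ

/-- The Hilbert space `ℓ²(ℤ^d)`. -/
abbrev Hilb (d : ℕ) : Type := lp (fun _ : Site d => ℂ) 2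

/-- A configuration of coupling constants in `[0,1]`, one for each point of `r ℤ^d`.
The point `r k` of `r ℤ^d` is labelled by `k ∈ ℤ^d`. -/
abbrev Config (d : ℕ) : Type := Site d → unitInterval

/-! ### The free operator -/

/-- Translation `(T_a f)(n) = f(n + a)` on `ℓ²(ℤ^d)`. -/
def translation {d : ℕ} (a : Site d) : Hilb d →L[ℂ] Hilb d :=
  LinearMap.mkContinuous
    { toFun := fun f => ⟨fun n => f (n + a), by
        have h := (lp.memℓp f).summable (by norm_num : 0 < (2 : ENNReal).toReal)
        exact memℓp_gen ((Equiv.addRight a).summable_iff.mpr h)⟩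
      map_add' := fun f g => by ext n; rfl
      map_smul' := fun c f => by ext n; rfl }
    1 (fun f => by
      have hp : 0 < (2 : ENNReal).toReal := by norm_num
      rw [one_mul]
      apply le_of_eq
      rw [lp.norm_eq_tsum_rpow hp, lp.norm_eq_tsum_rpow hp]
      congr 1
      exact (Equiv.addRight a).tsum_eq (fun n => ‖f n‖ ^ (2 : ENNReal).toReal))

theorem translation_apply {d : ℕ} (a : Site d) (f : Hilb d) (n : Site d) :
    translation a f n = f (n + a) := rfl

/-- The discrete Laplacian `(H₀ f)(n) = 2 d f(n) - ∑_{|k - n| = 1} f(k)`;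
the nearest neighbours of `n` are the points `n ± e_i`. -/
def freeOp (d : ℕ) : Hilb d →L[ℂ] Hilb d :=
  (2 * (d : ℂ)) • ContinuousLinearMap.id ℂ (Hilb d) -
    ∑ i : Fin d, (translation (Pi.single i 1) + translation (-Pi.single i 1))

/-! ### The random potential -/

/-- The cube `Λ_r(r k) = ∏_j {r k_j, …, r k_j + r - 1}`. -/
def cube {d : ℕ} (r : ℕ) (k : Site d) : Set (Site d) :=
  {n | ∀ j, (r : ℤ) * k j ≤ n j ∧ n j ≤ (r : ℤ) * k j + r - 1}

theorem cube_unique {d r : ℕ} {k k' n : Site d} (h : n ∈ cube r k) (h' : n ∈ cube r k') :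
    k = k' := by
  funext j
  obtain ⟨h1, h2⟩ := h j
  obtain ⟨h3, h4⟩ := h' j
  have hr : (0 : ℤ) ≤ r := Int.natCast_nonneg r
  by_contra hne
  rcases lt_or_gt_of_ne hne with hlt | hlt <;> nlinarith

/-- The function `n ↦ ∑_k ω_k χ_{Λ_r(r k)}(n)`. The cubes are disjoint, so at most one term of the
sum is nonzero. -/
def potential {d : ℕ} (r : ℕ) (ω : Config d) (n : Site d) : ℝ :=
  ∑ᶠ k : Site d, (ω k : ℝ) * (cube r k).indicator 1 n

theorem potential_of_mem {d r : ℕ} (ω : Config d) {n k : Site d} (h : n ∈ cube r k) :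
    potential r ω n = ω k := by
  rw [potential, finsum_eq_single _ k]
  · simp [Set.indicator_of_mem h]
  · intro k' hk'
    rw [Set.indicator_of_notMem (fun h' => hk' (cube_unique h' h)), mul_zero]

theorem abs_potential_le {d r : ℕ} (ω : Config d) (n : Site d) : |potential r ω n| ≤ 1 := by
  by_cases h : ∃ k, n ∈ cube r k
  · obtain ⟨k, hk⟩ := h
    rw [potential_of_mem ω hk, abs_of_nonneg (ω k).2.1]
    exact (ω k).2.2
  · have : ∀ k : Site d, (ω k : ℝ) * (cube r k).indicator 1 n = 0 := fun k => by
      rw [Set.indicator_of_notMem (fun h' => h ⟨k, h'⟩), mul_zero]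
    simp [potential, this]

/-- The potential `V_ω = ∑_k ω_k P_k`, where `P_k` is multiplication by the characteristic function
of `Λ_r(r k)`: multiplication by `potential r ω`. -/
def potentialOp {d : ℕ} (r : ℕ) (ω : Config d) : Hilb d →L[ℂ] Hilb d :=
  lp.mapCLM 2 (fun n => ((potential r ω n : ℝ) : ℂ) • ContinuousLinearMap.id ℂ ℂ)
    zero_le_one (fun n => by
      refine (ContinuousLinearMap.opNorm_smul_le _ _).trans ?_
      rw [ContinuousLinearMap.norm_id, mul_one, Complex.norm_real]
      exact abs_potential_le ω n)

theorem potentialOp_apply {d r : ℕ} (ω : Config d) (f : Hilb d) (n : Site d) :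
    potentialOp r ω f n = (potential r ω n : ℂ) * f n := by
  simp [potentialOp]

/-- The higher-rank Anderson operator `H_ω = H₀ + V_ω` on `ℓ²(ℤ^d)`. -/
def anderson {d : ℕ} (r : ℕ) (ω : Config d) : Hilb d →L[ℂ] Hilb d :=
  freeOp d + potentialOp r ω

theorem anderson_apply {d r : ℕ} (ω : Config d) (f : Hilb d) (n : Site d) :
    anderson r ω f n = 2 * (d : ℂ) * f n
      - ∑ i : Fin d, (f (n + Pi.single i 1) + f (n - Pi.single i 1))
      + (potential r ω n : ℂ) * f n := by
  have hsum : (∑ i : Fin d, (translation (Pi.single i 1) +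
      translation (-Pi.single i 1)) : Hilb d →L[ℂ] Hilb d) f n =
      ∑ i : Fin d, (f (n + Pi.single i 1) + f (n - Pi.single i 1)) := by
    rw [sum_apply, lp.coeFn_sum, Finset.sum_apply]
    refine Finset.sum_congr rfl fun i _ => ?_
    rw [add_apply, lp.coeFn_add, Pi.add_apply, translation_apply,
      translation_apply, sub_eq_add_neg]
  rw [anderson, freeOp, add_apply, lp.coeFn_add, Pi.add_apply,
    potentialOp_apply, sub_apply, lp.coeFn_sub, Pi.sub_apply, hsum]
  simp

theorem anderson_isSymmetric {d : ℕ} (r : ℕ) (ω : Config d) :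
    (anderson r ω : Hilb d →ₗ[ℂ] Hilb d).IsSymmetric := by
  have ht : ∀ (a : Site d) (f g : Hilb d),
      inner ℂ (translation a f) g = inner ℂ f (translation (-a) g) := by
    intro a f g
    rw [lp.inner_eq_tsum, lp.inner_eq_tsum,
      ← (Equiv.addRight a).tsum_eq (fun n => inner ℂ (f n) (translation (-a) g n))]
    refine tsum_congr fun n => ?_
    rw [translation_apply, translation_apply, Equiv.coe_addRight, add_neg_cancel_right]
  have hv : ∀ f g : Hilb d,
      inner ℂ (potentialOp r ω f) g = inner ℂ f (potentialOp r ω g) := by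
    intro f g
    rw [lp.inner_eq_tsum, lp.inner_eq_tsum]
    refine tsum_congr fun n => ?_
    rw [potentialOp_apply, potentialOp_apply]
    simp only [RCLike.inner_apply, map_mul, Complex.conj_ofReal]
    ring
  intro f g
  simp only [anderson, freeOp, ContinuousLinearMap.coe_coe, add_apply,
    sub_apply, smul_apply, ContinuousLinearMap.id_apply,
    sum_apply, inner_add_left, inner_add_right, inner_sub_left,
    inner_sub_right, sum_inner, inner_sum, ht, hv, neg_neg, inner_smul_left, inner_smul_right,
    map_mul, map_natCast, map_ofNat]
  congr 2
  exact Finset.sum_congr rfl fun i _ => add_comm _ _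

/-! ### Localization and simplicity -/

/-- The set `[0, E] ∪ [4d + 1 - E, 4d + 1]` of energies near the two edges of the
deterministic spectrum `[0, 4d + 1]`. -/
def bandEdges (d : ℕ) (E : ℝ) : Set ℝ :=
  Set.Icc 0 E ∪ Set.Icc (4 * d + 1 - E) (4 * d + 1)

/-- The constant `γ_{∞,r} = 1 - cos (π / r)`. -/
def gammaInfty (r : ℕ) : ℝ := 1 - Real.cos (Real.pi / r)

/-- The eigenspace of `H_ω` at the energy `E`. -/
def energySpace {d : ℕ} (r : ℕ) (ω : Config d) (E : ℝ) : Submodule ℂ (Hilb d) :=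
  Module.End.eigenspace (anderson r ω : Hilb d →ₗ[ℂ] Hilb d) (E : ℂ)

/-- The real number `E` is an eigenvalue of `H_ω`. -/
def IsEigenvalue {d : ℕ} (r : ℕ) (ω : Config d) (E : ℝ) : Prop :=
  Module.End.HasEigenvalue (anderson r ω : Hilb d →ₗ[ℂ] Hilb d) (E : ℂ)

/-- The continuous subspace of `H_ω`: the orthogonal complement of the span of all
eigenvectors. -/
def continuousSubspace {d : ℕ} (r : ℕ) (ω : Config d) : Submodule ℂ (Hilb d) :=
  (⨆ μ : ℂ, Module.End.eigenspace (anderson r ω : Hilb d →ₗ[ℂ] Hilb d) μ)ᗮ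

/-- The restriction of `H_ω` to its continuous subspace, which it leaves invariant. -/
def continuousPart {d : ℕ} (r : ℕ) (ω : Config d) :
    continuousSubspace r ω →L[ℂ] continuousSubspace r ω :=
  (anderson r ω).restrict (p := continuousSubspace r ω) (q := continuousSubspace r ω)
    (fun _ hf => (anderson_isSymmetric r ω).orthogonalComplement_iSup_eigenspaces_invariant hf)

/-- The spectrum of `H_ω` in `S` is pure point: the continuous spectrum of `H_ω`, that is the
spectrum of the restriction to the continuous subspace, does not meet `S`. -/
def PurePointOn {d : ℕ} (r : ℕ) (ω : Config d) (S : Set ℝ) : Prop :=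
  ∀ E ∈ S, (E : ℂ) ∉ spectrum ℂ (continuousPart r ω)

/-- Exponential decay of a function on `ℤ^d`; the amplitude `C` and the rate `c` may depend on the
function. (`‖n‖` is the sup norm, equivalent to every other norm.) -/
def ExpDecay {d : ℕ} (f : Hilb d) : Prop :=
  ∃ C c : ℝ, 0 < c ∧ ∀ n : Site d, ‖f n‖ ≤ C * Real.exp (-c * ‖n‖)

/-- `S` is in the region of localization of `H_ω`: the spectrum in `S` is pure point and all
eigenfunctions with eigenvalue in `S` decay exponentially. -/
def LocalizedOn {d : ℕ} (r : ℕ) (ω : Config d) (S : Set ℝ) : Prop :=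
  PurePointOn r ω S ∧ ∀ E ∈ S, ∀ f ∈ energySpace r ω E, ExpDecay f

/-- All eigenvalues of `H_ω` in `S` are simple. -/
def SimpleOn {d : ℕ} (r : ℕ) (ω : Config d) (S : Set ℝ) : Prop :=
  ∀ E ∈ S, IsEigenvalue r ω E → Module.finrank ℂ (energySpace r ω E) = 1

end HigherRankAnderson

end

open HigherRankAnderson

/-! Suppose an energy `E` near a band edge carries an orthonormal pair `u`, `v` of eigenfunctions.
Compress each `P_k` to the span of the pair; two cases arise.

If every compression is a scalar, then on each cube `u` and `v` are orthogonal with equal norms. By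
Bessel, two such functions cannot both be nearly constant: their squared means use up at most half
of their total mass. The Poincaré inequality with constant `2 γ_{∞,r}` then gives total kinetic
energy at least `2 γ_{∞,r}` (`kinetic_pair`). Since `0 ≤ V ≤ 1`, an eigenfunction has kinetic energy
at most `E`, or at most `4d + 1 - E` after a staggered sign change, so `E` is at distance at least
`γ_{∞,r}` from both edges (`energy_bounds_of_scalar`).

If some `P_k` is not a scalar on the pair, vary `ω_k` alone. By first order perturbation theory
(`coupling_identity`), a convergent family of such pairs makes the energy quotients converge to both
`⟨u, P_k u⟩` and `⟨v, P_k v⟩`, and forces `⟨u, P_k v⟩ = 0`. Hence the bad pairs do not accumulate at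
one another, and the bad values of `ω_k` are countable (`countable_nonscalar`). The law of `ω_k` has
no atoms, so Fubini makes the bad configurations null. Localization places the eigenfunctions in
countably many compact sets of dominated functions; this supplies both the measurability and the
convergence of inner products. -/

noncomputable section
namespace HigherRankAnderson

/-! ### Poincaré inequalities on paths and boxes -/

/-- Discrete Hardy-type identity: the Dirichlet form dominates the potential given by a positive
supersolution. -/
theorem sq_sub_ge_of_pos {s t a b : ℝ} (hs : 0 < s) (ht : 0 < t) :
    a ^ 2 * ((s - t) / s) + b ^ 2 * ((t - s) / t) ≤ (b - a) ^ 2 := by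
  have h : (b - a) ^ 2 - (a ^ 2 * ((s - t) / s) + b ^ 2 * ((t - s) / t)) =
      (t * a - s * b) ^ 2 / (s * t) := by field_simp; ring
  have : 0 ≤ (t * a - s * b) ^ 2 / (s * t) := by positivity
  linarith

/-- The Dirichlet Laplacian on `{1, …, r - 1}` is at least `2 - 2 cos (π / r)`. -/
theorem dirichlet_path (r : ℕ) (b : ℕ → ℝ) (h0 : b 0 = 0) (hr : b (r + 1) = 0) :
    (2 - 2 * Real.cos (Real.pi / (r + 1))) * ∑ j ∈ Finset.range (r + 1), b j ^ 2 ≤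
      ∑ j ∈ Finset.range (r + 1), (b (j + 1) - b j) ^ 2 := by
  set θ : ℝ := Real.pi / (r + 1) with hθ
  have hθ0 : 0 < θ := by positivity
  have hθr : (r + 1 : ℝ) * θ = Real.pi := by rw [hθ]; field_simp
  -- The Dirichlet ground state: positive inside, zero at `0` and `r + 1`. It serves as the
  -- comparison function on each bond.
  set s : ℕ → ℝ := fun j => Real.sin (j * θ) with hs
  have hpos : ∀ j : ℕ, 1 ≤ j → j ≤ r → 0 < s j := by
    intro j h1 h2
    have h1' : (1 : ℝ) ≤ j := by exact_mod_cast h1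
    have h2' : (j : ℝ) ≤ r := by exact_mod_cast h2
    apply Real.sin_pos_of_pos_of_lt_pi
    · positivity
    · nlinarith
  have hrec : ∀ j : ℕ, s (j + 2) + s j = 2 * Real.cos θ * s (j + 1) := by
    intro j
    simp only [hs]
    have e1 : ((j + 2 : ℕ) : ℝ) * θ = ((j + 1 : ℕ) : ℝ) * θ + θ := by push_cast; ring
    have e2 : (j : ℝ) * θ = ((j + 1 : ℕ) : ℝ) * θ - θ := by push_cast; ring
    rw [e1, e2, Real.sin_add, Real.sin_sub]; ring
  have hs0 : s 0 = 0 := by simp [hs]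
  have hsr : s (r + 1) = 0 := by simp [hs, hθr]
  -- partial sums, with boundary term
  have key : ∀ m : ℕ, m + 1 ≤ r →
      (2 - 2 * Real.cos θ) * ∑ j ∈ Finset.range (m + 1), b j ^ 2 +
        b (m + 1) ^ 2 * ((s (m + 1) - s m) / s (m + 1)) ≤
      ∑ j ∈ Finset.range (m + 1), (b (j + 1) - b j) ^ 2 := by
    intro m
    induction m with
    | zero =>
      intro hm
      have := hpos 1 le_rfl hm
      simp only [zero_add, Finset.range_one, Finset.sum_singleton, h0, hs0, sub_zero]
      rw [div_self this.ne']; simp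
    | succ m ih =>
      intro hm
      have ih := ih (by omega)
      have p1 := hpos (m + 1) (by omega) (by omega)
      have p2 := hpos (m + 2) (by omega) (by omega)
      rw [Finset.sum_range_succ, Finset.sum_range_succ _ (m + 1)]
      have h1 := sq_sub_ge_of_pos (a := b (m + 1)) (b := b (m + 2)) p1 p2
      have h2 : (s (m + 1) - s (m + 2)) / s (m + 1) + 2 * Real.cos θ - 2 +
          (s (m + 1) - s m) / s (m + 1) = 0 := by
        field_simp
        linarith [hrec m]
      have h3 : b (m + 1) ^ 2 * ((s (m + 1) - s (m + 2)) / s (m + 1)) =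
        b (m + 1) ^ 2 * (2 - 2 * Real.cos θ) -
          b (m + 1) ^ 2 * ((s (m + 1) - s m) / s (m + 1)) := by
        rw [← mul_sub]; congr 1; linarith
      simp only [add_assoc, Nat.reduceAdd] at *
      linarith
  rcases r with _ | m
  · simp [h0, hr]
  -- The last bond is treated apart, because `s` vanishes at its endpoint and cannot be a
  -- denominator there; `b` vanishes there as well.
  · have h1 := key m le_rfl
    rw [Finset.sum_range_succ, Finset.sum_range_succ _ (m + 1), hr]
    have p1 := hpos (m + 1) (by omega) (by omega)
    have h2 : (s (m + 1) - s m) / s (m + 1) = 1 - (2 * Real.cos θ - 0) := by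
      have := hrec m
      rw [hsr] at this
      field_simp
      linarith
    rw [h2] at h1
    nlinarith

/-- The sharp Poincaré inequality on a path, for functions with mean zero. -/
theorem poincare_path_of_sum_eq_zero (r : ℕ) (a : ℕ → ℝ)
    (h0 : ∑ j ∈ Finset.range (r + 1), a j = 0) :
    (2 - 2 * Real.cos (Real.pi / (r + 1))) * ∑ j ∈ Finset.range (r + 1), a j ^ 2 ≤
      ∑ j ∈ Finset.range r, (a (j + 1) - a j) ^ 2 := by
  -- Mean zero makes the partial sums vanish at both ends, so the Dirichlet bound applies to `S`,
  -- whose differences are `a`. Summation by parts and Cauchy–Schwarz carry it over to the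
  -- differences of `a`.
  set S : ℕ → ℝ := fun j => ∑ i ∈ Finset.range j, a i with hS
  have hSs : ∀ j, S (j + 1) = S j + a j := fun j => Finset.sum_range_succ _ _
  have hD := dirichlet_path r S (by simp [hS]) h0
  simp only [hSs, add_sub_cancel_left] at hD
  have hparts : ∀ m, ∑ j ∈ Finset.range (m + 1), a j ^ 2 = S (m + 1) * a m -
      ∑ j ∈ Finset.range m, S (j + 1) * (a (j + 1) - a j) := by
    intro m
    induction m with
    | zero => simp [hSs, show S 0 = 0 by simp [hS]]; ring
    | succ m ih => rw [Finset.sum_range_succ, ih, Finset.sum_range_succ _ m, hSs (m + 1)]; ring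
  have hp := hparts r
  rw [show S (r + 1) = 0 from h0, zero_mul, zero_sub] at hp
  rw [Finset.sum_range_succ' (fun j => S j ^ 2), show S 0 = 0 by simp [hS]] at hD
  have hcs := Finset.sum_mul_sq_le_sq_mul_sq (Finset.range r) (fun j => S (j + 1))
    (fun j => a (j + 1) - a j)
  set lam := 2 - 2 * Real.cos (Real.pi / (r + 1))
  have hlam : 0 ≤ lam := by
    have := Real.cos_le_one (Real.pi / (r + 1)); simp only [lam]; linarith
  set A := ∑ j ∈ Finset.range (r + 1), a j ^ 2
  set Q := ∑ j ∈ Finset.range r, (a (j + 1) - a j) ^ 2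
  set W := ∑ j ∈ Finset.range r, S (j + 1) ^ 2
  have hA : 0 ≤ A := Finset.sum_nonneg fun _ _ => sq_nonneg _
  have hQ : 0 ≤ Q := Finset.sum_nonneg fun _ _ => sq_nonneg _
  have hA2 : A ^ 2 ≤ W * Q := by rw [hp]; simpa using hcs
  rcases hA.eq_or_lt with h | h
  · rw [← h]; simpa using hQ
  · have : lam * W ≤ A := by simpa using hD
    have h3 : lam * A * A ≤ Q * A := by nlinarith
    exact le_of_mul_le_mul_right h3 h

/-- The sharp Poincaré inequality on a path with `r` vertices. -/
theorem poincare_path (r : ℕ) (hr : 1 ≤ r) (a : ℕ → ℝ) :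
    2 * gammaInfty r * (∑ j ∈ Finset.range r, a j ^ 2 - (∑ j ∈ Finset.range r, a j) ^ 2 / r) ≤
      ∑ j ∈ Finset.range (r - 1), (a (j + 1) - a j) ^ 2 := by
  obtain ⟨r, rfl⟩ : ∃ s, r = s + 1 := ⟨r - 1, by omega⟩
  set M := (∑ j ∈ Finset.range (r + 1), a j) / (r + 1 : ℝ) with hM
  have hM' : (∑ j ∈ Finset.range (r + 1), a j) = M * (r + 1 : ℝ) := by rw [hM]; field_simp
  have h := poincare_path_of_sum_eq_zero r (fun j => a j - M) (by
    rw [Finset.sum_sub_distrib, hM']; simp; ring)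
  simp only [sub_sub_sub_cancel_right] at h
  have e : ∑ j ∈ Finset.range (r + 1), (a j - M) ^ 2 = ∑ j ∈ Finset.range (r + 1), a j ^ 2 -
      (∑ j ∈ Finset.range (r + 1), a j) ^ 2 / ((r + 1 : ℕ) : ℝ) := by
    simp only [sub_sq, Finset.sum_add_distrib, Finset.sum_sub_distrib, ← Finset.sum_mul,
      ← Finset.mul_sum]
    rw [hM']; simp; field_simp; ring
  rw [e] at h
  simpa [gammaInfty, mul_sub] using h

theorem gammaInfty_nonneg (r : ℕ) : 0 ≤ gammaInfty r :=
  sub_nonneg.mpr (Real.cos_le_one _)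

/-- The sharp Poincaré inequality on a path, for functions on `Fin r`. -/
theorem poincare_path_fin (r : ℕ) (a : Fin r → ℝ) :
    2 * gammaInfty r * (∑ j, a j ^ 2 - (∑ j, a j) ^ 2 / r) ≤
      ∑ j : Fin r, if h : (j : ℕ) + 1 < r then (a ⟨j + 1, h⟩ - a j) ^ 2 else 0 := by
  rcases Nat.eq_zero_or_pos r with rfl | hr
  · simp
  set b : ℕ → ℝ := fun j => if h : j < r then a ⟨j, h⟩ else 0 with hb
  have hba : ∀ j : Fin r, a j = b j := fun j => by simp [hb]
  have h := poincare_path r hr b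
  rw [Finset.sum_range, Finset.sum_range] at h
  simp only [hba]
  refine h.trans (le_of_eq ?_)
  have e : ∀ j : Fin r, (if h : (j : ℕ) + 1 < r then (b (j + 1) - b j) ^ 2 else 0) =
      (fun j : ℕ => if j + 1 < r then (b (j + 1) - b j) ^ 2 else 0) j := fun j => by simp
  simp only [e]
  rw [← Finset.sum_range (fun j : ℕ => if j + 1 < r then (b (j + 1) - b j) ^ 2 else 0)]
  obtain ⟨s, rfl⟩ : ∃ s, r = s + 1 := ⟨r - 1, by omega⟩
  rw [Finset.sum_range_succ, if_neg (lt_irrefl _), add_zero, Nat.add_sub_cancel]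
  refine Finset.sum_congr rfl fun j hj => ?_
  rw [if_pos (by simpa using hj)]

/-- Two-way analysis of variance. -/
theorem two_way_variance {ι κ : Type*} [Fintype ι] [Fintype κ] (N M : ℝ)
    (hN : N = Fintype.card ι) (hM : M = Fintype.card κ) (hN0 : 0 < N) (hM0 : 0 < M)
    (f : ι → κ → ℝ) :
    (∑ t, ∑ y, f t y ^ 2) - (∑ t, ∑ y, f t y) ^ 2 / (N * M) ≤
      (∑ y, (∑ t, f t y ^ 2 - (∑ t, f t y) ^ 2 / N)) +
        ∑ t, (∑ y, f t y ^ 2 - (∑ y, f t y) ^ 2 / M) := by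
  set R : ι → ℝ := fun t => ∑ y, f t y with hR
  set C : κ → ℝ := fun y => ∑ t, f t y with hC
  set T : ℝ := ∑ t, R t with hT
  have hCT : ∑ y, C y = T := Finset.sum_comm
  -- The summand is the interaction residual: `f` minus row mean minus column mean plus grand mean.
  -- Expanding its square sum gives the claim.
  have h0 : 0 ≤ ∑ t, ∑ y, (f t y - R t / M - C y / N + T / (N * M)) ^ 2 :=
    Finset.sum_nonneg fun _ _ => Finset.sum_nonneg fun _ _ => sq_nonneg _
  have hin : ∀ t, ∑ y, (f t y - R t / M - C y / N + T / (N * M)) ^ 2 =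
      ∑ y, f t y ^ 2 - R t ^ 2 / M - 2 / N * ∑ y, f t y * C y + (∑ y, C y ^ 2) / N ^ 2
        + 2 * R t * T / (N * M) - T ^ 2 / (N ^ 2 * M) := by
    intro t
    have : ∀ y, (f t y - R t / M - C y / N + T / (N * M)) ^ 2 =
      f t y ^ 2 + f t y * (2 * (T / (N * M) - R t / M)) - 2 / N * (f t y * C y)
       + C y ^ 2 / N ^ 2 - C y * (2 / N * (T / (N * M) - R t / M)) +
       (T / (N * M) - R t / M) ^ 2 := fun y => by ring
    simp only [this, Finset.sum_add_distrib, Finset.sum_sub_distrib, ← Finset.sum_mul,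
      ← Finset.mul_sum, ← Finset.sum_div, hCT, Finset.sum_const, Finset.card_univ, nsmul_eq_mul,
      ← hM]
    simp only [show ∑ y, f t y = R t from rfl]
    field_simp
    ring
  have hmix : ∑ t, ∑ y, f t y * C y = ∑ y, C y ^ 2 := by
    rw [Finset.sum_comm]
    refine Finset.sum_congr rfl fun y _ => ?_
    rw [← Finset.sum_mul, sq]
  simp only [hin, Finset.sum_add_distrib, Finset.sum_sub_distrib, ← Finset.sum_mul,
      ← Finset.mul_sum, ← Finset.sum_div, hmix, Finset.sum_const, Finset.card_univ, nsmul_eq_mul,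
      ← hN] at h0
  simp only [← hT] at h0
  simp only [Finset.sum_sub_distrib, ← Finset.sum_div]
  rw [Finset.sum_comm (f := fun y t => f t y ^ 2)]
  simp only [show ∀ y, ∑ t, f t y = C y from fun _ => rfl, show ∀ t, ∑ y, f t y = R t from fun _ => rfl]
  have e : (∑ t, ∑ y, f t y ^ 2) - (∑ t, R t ^ 2) / M - 2 / N * ∑ y, C y ^ 2
      + (N * ∑ y, C y ^ 2) / N ^ 2 + 2 * T * T / (N * M) - N * T ^ 2 / (N ^ 2 * M) =
      (∑ t, ∑ y, f t y ^ 2) - (∑ t, R t ^ 2) / M - (∑ y, C y ^ 2) / N + T ^ 2 / (N * M) := by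
    field_simp
    ring
  rw [e] at h0
  linarith

/-- The Efron–Stein inequality for the uniform measure on a finite cube. -/
theorem efron_stein {α : Type*} [Fintype α] [Nonempty α] :
    ∀ (d : ℕ) (f : (Fin d → α) → ℝ),
    ∑ x, f x ^ 2 - (∑ x, f x) ^ 2 / (Fintype.card α : ℝ) ^ d ≤
      ∑ i, ∑ x, (∑ s, f (Function.update x i s) ^ 2 -
        (∑ s, f (Function.update x i s)) ^ 2 / Fintype.card α) / Fintype.card α := by
  intro d
  have hN : (0 : ℝ) < Fintype.card α := by exact_mod_cast Fintype.card_pos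
  induction d with
  | zero => intro f; simp
  | succ d ih =>
    intro f
    have hsum : ∀ F : (Fin (d + 1) → α) → ℝ, ∑ x, F x =
        ∑ t : α, ∑ y : Fin d → α, F (Fin.cons t y : Fin (d + 1) → α) := by
      intro F
      rw [← Fintype.sum_prod_type', ← (Fin.consEquiv (fun _ => α)).sum_comp]
      rfl
    rw [Fin.sum_univ_succ]
    simp only [hsum, Fin.update_cons_zero, ← Fin.cons_update]
    -- The first coordinate is split off from the rest; the induction hypothesis bounds the variance
    -- in the remaining ones.
    have h2 := two_way_variance (Fintype.card α : ℝ) ((Fintype.card α : ℝ) ^ d) rfl (by simp) hN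
      (by positivity) (fun (t : α) (y : Fin d → α) => f (Fin.cons t y : Fin (d + 1) → α))
    rw [pow_succ' (Fintype.card α : ℝ) d]
    refine h2.trans (add_le_add (le_of_eq ?_) ?_)
    · rw [Finset.sum_const, Finset.card_univ, nsmul_eq_mul, ← Finset.sum_div,
        mul_div_cancel₀ _ hN.ne']
    · rw [Finset.sum_comm]
      exact Finset.sum_le_sum fun t _ => ih fun y => f (Fin.cons t y : Fin (d + 1) → α)

/-- The map `(x, s) ↦ (update x i s, x i)` is an involution. -/
theorem sum_sum_update {ι α : Type*} [Fintype ι] [DecidableEq ι] [Fintype α] (i : ι)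
    (F : (ι → α) → ℝ) :
    ∑ x, ∑ s, F (Function.update x i s) = Fintype.card α * ∑ x, F x := by
  have e : ∑ p : (ι → α) × α, F (Function.update p.1 i p.2) = ∑ p : (ι → α) × α, F p.1 :=
    Fintype.sum_bijective (fun p : (ι → α) × α => (Function.update p.1 i p.2, p.1 i))
      (Function.Involutive.bijective fun p => by simp) _ _ fun p => rfl
  rw [Fintype.sum_prod_type, Fintype.sum_prod_type] at e
  rw [e]
  simp [Finset.mul_sum]

/-- The Neumann Dirichlet form on the box `{0, …, r - 1}^d`. -/
def boxEnergy {d r : ℕ} {E : Type*} [NormedAddCommGroup E] (f : (Fin d → Fin r) → E) : ℝ :=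
  ∑ i, ∑ x : Fin d → Fin r,
    if h : (x i : ℕ) + 1 < r then ‖f (Function.update x i ⟨x i + 1, h⟩) - f x‖ ^ 2 else 0

/-- The sharp Poincaré inequality on a box, for real functions. -/
theorem poincare_box_real {d r : ℕ} (hr : 1 ≤ r) (f : (Fin d → Fin r) → ℝ) :
    2 * gammaInfty r * (∑ x, f x ^ 2 - (∑ x, f x) ^ 2 / (r : ℝ) ^ d) ≤ boxEnergy f := by
  have : Nonempty (Fin r) := ⟨⟨0, hr⟩⟩
  have hr0 : (0 : ℝ) < r := by exact_mod_cast hr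
  have h := mul_le_mul_of_nonneg_left (efron_stein d f)
    (mul_nonneg zero_le_two (gammaInfty_nonneg r))
  rw [Fintype.card_fin] at h
  refine h.trans ?_
  rw [Finset.mul_sum]
  refine Finset.sum_le_sum fun i _ => ?_
  -- Each line in direction `i` is counted once for every value of `x i`, that is `r` times; this
  -- cancels the denominator in `efron_stein`.
  have key := sum_sum_update i (fun x : Fin d → Fin r =>
    if h : (x i : ℕ) + 1 < r then ‖f (Function.update x i ⟨x i + 1, h⟩) - f x‖ ^ 2 else 0)
  rw [Fintype.card_fin] at key
  rw [← Finset.sum_div, ← mul_div_assoc, div_le_iff₀ hr0, mul_comm _ (r : ℝ), ← key,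
    Finset.mul_sum]
  refine Finset.sum_le_sum fun x _ => ?_
  refine (poincare_path_fin r fun s => f (Function.update x i s)).trans (le_of_eq ?_)
  refine Finset.sum_congr rfl fun s _ => ?_
  simp

/-- The sharp Poincaré inequality on a box. -/
theorem poincare_box {d r : ℕ} (hr : 1 ≤ r) (f : (Fin d → Fin r) → ℂ) :
    2 * gammaInfty r * (∑ x, ‖f x‖ ^ 2 - ‖∑ x, f x‖ ^ 2 / (r : ℝ) ^ d) ≤ boxEnergy f := by
  have hn : ∀ z : ℂ, ‖z‖ ^ 2 = z.re ^ 2 + z.im ^ 2 := fun z => by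
    rw [Complex.sq_norm, Complex.normSq_apply]; ring
  have h1 := poincare_box_real hr fun x => (f x).re
  have h2 := poincare_box_real hr fun x => (f x).im
  have e : boxEnergy f = boxEnergy (fun x => (f x).re) + boxEnergy (fun x => (f x).im) := by
    simp only [boxEnergy, ← Finset.sum_add_distrib]
    refine Finset.sum_congr rfl fun i _ => Finset.sum_congr rfl fun x _ => ?_
    split_ifs
    · rw [hn]; simp
    · simp
  rw [e]
  simp only [hn, Complex.re_sum, Complex.im_sum, Finset.sum_add_distrib]
  rw [add_div]
  linarith

/-! ### Orthogonal pairs on one cube -/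

/-- Bessel's inequality for the constant function and two orthogonal functions of equal norm. -/
theorem bessel_const {ι : Type*} [Fintype ι] (f g : ι → ℂ) (c : ℝ)
    (hf : ∑ x, ‖f x‖ ^ 2 = c) (hg : ∑ x, ‖g x‖ ^ 2 = c)
    (hfg : ∑ x, (starRingEnd ℂ) (f x) * g x = 0) :
    ‖∑ x, f x‖ ^ 2 + ‖∑ x, g x‖ ^ 2 ≤ Fintype.card ι * c := by
  set α := ∑ x, f x
  set β := ∑ x, g x
  have hc : 0 ≤ c := hf ▸ Finset.sum_nonneg fun _ _ => sq_nonneg _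
  -- The combination of `f` and `g` best aligned with the constants: its sum is `s` and its squared
  -- norm is `s * c`, so Cauchy–Schwarz gives `s ^ 2 ≤ card * s * c`.
  set h : ι → ℂ := fun x => (starRingEnd ℂ) α * f x + (starRingEnd ℂ) β * g x with hh
  set s := ‖α‖ ^ 2 + ‖β‖ ^ 2 with hs
  have h1 : ∑ x, h x = (s : ℂ) := by
    simp only [hh, Finset.sum_add_distrib, ← Finset.mul_sum]
    rw [Complex.conj_mul', Complex.conj_mul', hs]; push_cast; rfl
  have h2 : ∑ x, ‖h x‖ ^ 2 = s * c := by
    have : ∀ x, ‖h x‖ ^ 2 = ‖α‖ ^ 2 * ‖f x‖ ^ 2 + ‖β‖ ^ 2 * ‖g x‖ ^ 2 +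
        2 * (α * (starRingEnd ℂ) β * ((starRingEnd ℂ) (f x) * g x)).re := by
      intro x
      rw [Complex.sq_norm, hh, Complex.normSq_add, Complex.normSq_mul, Complex.normSq_mul,
        Complex.normSq_conj, Complex.normSq_conj]
      simp only [Complex.sq_norm]
      congr 2
      rw [← Complex.conj_re]
      congr 1
      simp only [map_mul, Complex.conj_conj]; ring
    simp only [this, Finset.sum_add_distrib, ← Finset.mul_sum, ← Complex.re_sum, hfg, hf, hg]
    simp; ring
  have h3 : s ≤ ∑ x, ‖h x‖ := by
    have := norm_sum_le Finset.univ h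
    rw [h1, Complex.norm_real, Real.norm_of_nonneg (by positivity)] at this
    exact this
  have h4 := sq_sum_le_card_mul_sum_sq (s := Finset.univ) (f := fun x => ‖h x‖)
  rw [h2, Finset.card_univ] at h4
  have hs0 : 0 ≤ s := by positivity
  rcases hs0.eq_or_lt with h5 | h5
  · rw [← h5]; positivity
  · have : s * s ≤ s * (Fintype.card ι * c) := by nlinarith
    exact le_of_mul_le_mul_left this h5

/-- The sum of the two lowest Neumann eigenvalues bounds the energy of a pair of orthogonal
functions of equal norm. -/
theorem boxEnergy_pair {d r : ℕ} (hr : 1 ≤ r) (f g : (Fin d → Fin r) → ℂ) (c : ℝ)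
    (hf : ∑ x, ‖f x‖ ^ 2 = c) (hg : ∑ x, ‖g x‖ ^ 2 = c)
    (hfg : ∑ x, (starRingEnd ℂ) (f x) * g x = 0) :
    2 * gammaInfty r * c ≤ boxEnergy f + boxEnergy g := by
  have h1 := poincare_box hr f
  have h2 := poincare_box hr g
  have h3 := bessel_const f g c hf hg hfg
  rw [Fintype.card_fun, Fintype.card_fin, Fintype.card_fin, Nat.cast_pow] at h3
  have hr0 : (0 : ℝ) < (r : ℝ) ^ d := by
    have : (0 : ℝ) < r := by exact_mod_cast hr
    positivity
  -- The means remove at most `c` from the total mass `2 c`, leaving `c` for the Poincaré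
  -- inequality.
  have h4 : ‖∑ x, f x‖ ^ 2 / (r : ℝ) ^ d + ‖∑ x, g x‖ ^ 2 / (r : ℝ) ^ d ≤ c := by
    rw [← add_div, div_le_iff₀ hr0, mul_comm c]; exact h3
  have h5 := mul_le_mul_of_nonneg_left h4 (mul_nonneg zero_le_two (gammaInfty_nonneg r))
  rw [hf] at h1
  rw [hg] at h2
  nlinarith

/-! ### Decomposition of the lattice into cubes -/

/-- The points of the cube `Λ_r(r k)`, enumerated by `{0, …, r - 1}^d`. -/
def cubeSite {d : ℕ} (r : ℕ) (k : Site d) (x : Fin d → Fin r) : Site d :=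
  fun i => (r : ℤ) * k i + ((x i : ℕ) : ℤ)

theorem cubeSite_mem_cube {d : ℕ} (r : ℕ) (k : Site d) (x : Fin d → Fin r) :
    cubeSite r k x ∈ cube r k := by
  intro j
  have := (x j).2
  simp only [cubeSite]
  constructor <;> omega

theorem potential_cubeSite {d r : ℕ} (ω : Config d) (k : Site d) (x : Fin d → Fin r) :
    potential r ω (cubeSite r k x) = ω k :=
  potential_of_mem ω (cubeSite_mem_cube r k x)

theorem cubeSite_bijective {d r : ℕ} (hr : 1 ≤ r) :
    Function.Bijective fun p : Site d × (Fin d → Fin r) => cubeSite r p.1 p.2 := by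
  have hr0 : (0 : ℤ) < r := by exact_mod_cast hr
  constructor
  · rintro ⟨k, x⟩ ⟨k', x'⟩ h
    have hk : k = k' := by
      have h1 := cubeSite_mem_cube r k x
      simp only at h
      rw [h] at h1
      exact cube_unique h1 (cubeSite_mem_cube r k' x')
    subst hk
    simp only [Prod.mk.injEq, true_and]
    funext i
    have := congrFun h i
    simp only [cubeSite] at this
    exact Fin.ext (by omega)
  · intro n
    refine ⟨(fun i => n i / r, fun i => ⟨(n i % r).toNat, ?_⟩), ?_⟩
    · have := Int.emod_lt_of_pos (n i) hr0
      have := Int.emod_nonneg (n i) hr0.ne'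
      omega
    · funext i
      have h1 := Int.emod_nonneg (n i) hr0.ne'
      simp only [cubeSite]
      rw [Int.toNat_of_nonneg h1]
      exact Int.mul_ediv_add_emod (n i) r

theorem hasSum_cubes {d r : ℕ} (hr : 1 ≤ r) {E : Type*} [NormedAddCommGroup E] [CompleteSpace E]
    {F : Site d → E} {a : E} (h : HasSum F a) :
    HasSum (fun k => ∑ x : Fin d → Fin r, F (cubeSite r k x)) a := by
  have h1 := (Equiv.ofBijective _ (cubeSite_bijective (d := d) hr)).hasSum_iff.mpr h
  exact h1.prod_fiberwise fun k => hasSum_fintype _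

/-- The form `⟨u, P_k v⟩`. -/
def cubeInner {d : ℕ} (r : ℕ) (k : Site d) (u v : Site d → ℂ) : ℂ :=
  ∑ x : Fin d → Fin r, (starRingEnd ℂ) (u (cubeSite r k x)) * v (cubeSite r k x)

theorem cubeInner_self {d : ℕ} (r : ℕ) (k : Site d) (u : Site d → ℂ) :
    cubeInner r k u u = ((∑ x : Fin d → Fin r, ‖u (cubeSite r k x)‖ ^ 2 : ℝ) : ℂ) := by
  simp only [cubeInner, Complex.conj_mul']
  push_cast
  rfl

theorem cubeSite_update {d r : ℕ} (k : Site d) (x : Fin d → Fin r) (i : Fin d)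
    (h : (x i : ℕ) + 1 < r) :
    cubeSite r k (Function.update x i ⟨x i + 1, h⟩) = cubeSite r k x + Pi.single i 1 := by
  funext j
  by_cases hj : j = i
  · subst hj; simp [cubeSite, add_assoc]
  · simp [cubeSite, hj]

/-- Neumann bracketing: the bonds that leave the cube are dropped. -/
theorem boxEnergy_cubeSite_le {d r : ℕ} (k : Site d) (u : Site d → ℂ) :
    boxEnergy (fun x : Fin d → Fin r => u (cubeSite r k x)) ≤
      ∑ x : Fin d → Fin r, ∑ i, ‖u (cubeSite r k x + Pi.single i 1) - u (cubeSite r k x)‖ ^ 2 := by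
  rw [Finset.sum_comm]
  refine Finset.sum_le_sum fun i _ => Finset.sum_le_sum fun x _ => ?_
  split_ifs with h
  · simp only
    rw [cubeSite_update]
  · positivity

/-- The kinetic energy of an orthonormal pair on which all the `P_k` act as scalars is at least
`2 γ_{∞,r}`. -/
theorem kinetic_pair {d r : ℕ} (hr : 1 ≤ r) {u v : Site d → ℂ} {A B : ℝ}
    (hu : HasSum (fun n => ‖u n‖ ^ 2) 1)
    (hA : HasSum (fun n => ∑ i, ‖u (n + Pi.single i 1) - u n‖ ^ 2) A)
    (hB : HasSum (fun n => ∑ i, ‖v (n + Pi.single i 1) - v n‖ ^ 2) B)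
    (h0 : ∀ k, cubeInner r k u v = 0) (h1 : ∀ k, cubeInner r k u u = cubeInner r k v v) :
    2 * gammaInfty r ≤ A + B := by
  have hu' := (hasSum_cubes hr hu).mul_left (2 * gammaInfty r)
  have hAB := (hasSum_cubes hr hA).add (hasSum_cubes hr hB)
  rw [mul_one] at hu'
  refine hasSum_le (fun k => ?_) hu' hAB
  refine (boxEnergy_pair hr (fun x => u (cubeSite r k x)) (fun x => v (cubeSite r k x)) _ rfl ?_
    (h0 k)).trans (add_le_add (boxEnergy_cubeSite_le k u) (boxEnergy_cubeSite_le k v))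
  have := h1 k
  rw [cubeInner_self, cubeInner_self] at this
  exact_mod_cast this.symm

/-! ### Kinetic energy of eigenfunctions near the edges -/

theorem hasSum_norm_sq {d : ℕ} (f : Hilb d) : HasSum (fun n => ‖f n‖ ^ 2) (‖f‖ ^ 2) := by
  have h := lp.hasSum_norm (p := 2) (by norm_num) f
  simpa using h

theorem translation_inner {d : ℕ} (a : Site d) (f g : Hilb d) :
    inner ℂ (translation a f) g = inner ℂ f (translation (-a) g) := by
  rw [lp.inner_eq_tsum, lp.inner_eq_tsum,
    ← (Equiv.addRight a).tsum_eq (fun n => inner ℂ (f n) (translation (-a) g n))]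
  refine tsum_congr fun n => ?_
  rw [translation_apply, translation_apply, Equiv.coe_addRight, add_neg_cancel_right]

theorem norm_translation {d : ℕ} (a : Site d) (f : Hilb d) : ‖translation a f‖ = ‖f‖ := by
  have h1 := hasSum_norm_sq (translation a f)
  have h2 := (Equiv.addRight a).hasSum_iff.mpr (hasSum_norm_sq f)
  have := h1.unique h2
  exact (sq_eq_sq₀ (norm_nonneg _) (norm_nonneg _)).mp this

theorem re_inner_freeOp {d : ℕ} (f : Hilb d) :
    (inner ℂ f (freeOp d f)).re = 2 * d * ‖f‖ ^ 2 -
      ∑ i : Fin d, 2 * (inner ℂ f (translation (Pi.single i 1) f)).re := by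
  have h : ∀ i : Fin d, (inner ℂ f (translation (-Pi.single i 1) f)).re =
      (inner ℂ f (translation (Pi.single i 1) f)).re := fun i => by
    rw [← translation_inner, ← inner_conj_symm, Complex.conj_re]
  simp only [freeOp, sub_apply, smul_apply, ContinuousLinearMap.id_apply, sum_apply, add_apply,
    inner_sub_right, inner_smul_right, inner_sum, inner_add_right, Complex.sub_re, Complex.re_sum,
    Complex.add_re, h]
  rw [inner_self_eq_norm_sq_to_K]
  congr 1
  · rw [← RCLike.ofReal_pow]
    simp [-map_pow, -Complex.ofReal_pow]
  · exact Finset.sum_congr rfl fun i _ => by ring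

theorem potential_mem_Icc {d r : ℕ} (hr : 1 ≤ r) (ω : Config d) (n : Site d) :
    potential r ω n ∈ Set.Icc (0 : ℝ) 1 := by
  obtain ⟨⟨k, x⟩, rfl⟩ := (cubeSite_bijective hr).2 n
  simp only [potential_cubeSite]
  exact (ω k).2

theorem hasSum_inner_potentialOp {d r : ℕ} (ω : Config d) (f : Hilb d) :
    HasSum (fun n => potential r ω n * ‖f n‖ ^ 2) (inner ℂ f (potentialOp r ω f)).re := by
  have h := Complex.hasSum_re (lp.hasSum_inner f (potentialOp r ω f))
  convert h using 2 with n
  rw [potentialOp_apply, RCLike.inner_apply, mul_assoc, Complex.mul_conj']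
  norm_cast

theorem eigen_inner {d r : ℕ} {ω : Config d} {E : ℝ} {f : Hilb d} (hf : f ∈ energySpace r ω E) :
    (inner ℂ f (freeOp d f)).re + (inner ℂ f (potentialOp r ω f)).re = E * ‖f‖ ^ 2 := by
  have h : anderson r ω f = (E : ℂ) • f := Module.End.mem_eigenspace_iff.mp hf
  have h2 : inner ℂ f (anderson r ω f) = E * ‖f‖ ^ 2 := by
    rw [h, inner_smul_right, inner_self_eq_norm_sq_to_K]; rfl
  have h3 := congrArg Complex.re h2
  rw [anderson, add_apply, inner_add_right, Complex.add_re] at h3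
  rw [h3]
  norm_cast

/-- The left side is `⟨f, H₀ f⟩`, and `V_ω ≥ 0`. -/
theorem kinetic_lower_edge {d r : ℕ} (hr : 1 ≤ r) {ω : Config d} {E : ℝ} {f : Hilb d}
    (hf : f ∈ energySpace r ω E) :
    ∑ i : Fin d, ‖translation (Pi.single i 1) f - f‖ ^ 2 ≤ E * ‖f‖ ^ 2 := by
  have h1 := eigen_inner hf
  have h2 : 0 ≤ (inner ℂ f (potentialOp r ω f)).re :=
    (hasSum_inner_potentialOp ω f).nonneg fun n =>
      mul_nonneg (potential_mem_Icc hr ω n).1 (sq_nonneg _)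
  have h3 : ∀ i : Fin d, ‖translation (Pi.single i 1) f - f‖ ^ 2 = 2 * ‖f‖ ^ 2 -
      2 * (inner ℂ f (translation (Pi.single i 1) f)).re := fun i => by
    rw [@norm_sub_sq ℂ, norm_translation, ← inner_conj_symm, RCLike.conj_re]
    simp only [RCLike.re_to_complex]
    ring
  rw [re_inner_freeOp] at h1
  simp only [h3, Finset.sum_sub_distrib, Finset.sum_const, Finset.card_univ, Fintype.card_fin,
    nsmul_eq_mul]
  linarith

/-- The left side is `⟨f, (4d - H₀) f⟩`, and `V_ω ≤ 1`. -/
theorem kinetic_upper_edge {d r : ℕ} (hr : 1 ≤ r) {ω : Config d} {E : ℝ} {f : Hilb d}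
    (hf : f ∈ energySpace r ω E) :
    ∑ i : Fin d, ‖translation (Pi.single i 1) f + f‖ ^ 2 ≤ (4 * d + 1 - E) * ‖f‖ ^ 2 := by
  have h1 := eigen_inner hf
  have h2 : (inner ℂ f (potentialOp r ω f)).re ≤ ‖f‖ ^ 2 :=
    hasSum_le (fun n => mul_le_of_le_one_left (sq_nonneg _) (potential_mem_Icc hr ω n).2)
      (hasSum_inner_potentialOp ω f) (hasSum_norm_sq f)
  have h3 : ∀ i : Fin d, ‖translation (Pi.single i 1) f + f‖ ^ 2 = 2 * ‖f‖ ^ 2 +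
      2 * (inner ℂ f (translation (Pi.single i 1) f)).re := fun i => by
    rw [@norm_add_sq ℂ, norm_translation, ← inner_conj_symm, RCLike.conj_re]
    simp only [RCLike.re_to_complex]
    ring
  rw [re_inner_freeOp] at h1
  simp only [h3, Finset.sum_add_distrib, Finset.sum_const, Finset.card_univ, Fintype.card_fin,
    nsmul_eq_mul]
  linarith

/-- The staggered sign `(-1)^{n_1 + ⋯ + n_d}`. -/
def stagger {d : ℕ} (n : Site d) : ℂ := (-1) ^ (∑ i, n i)

theorem norm_stagger {d : ℕ} (n : Site d) : ‖stagger n‖ = 1 := by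
  simp [stagger]

theorem conj_stagger_mul {d : ℕ} (n : Site d) : (starRingEnd ℂ) (stagger n) * stagger n = 1 := by
  rw [Complex.conj_mul', norm_stagger]; simp

theorem stagger_add_single {d : ℕ} (n : Site d) (i : Fin d) :
    stagger (n + Pi.single i 1) = -stagger n := by
  simp only [stagger, Pi.add_apply, Finset.sum_add_distrib, Finset.sum_pi_single',
    Finset.mem_univ, if_true]
  rw [zpow_add₀ (by norm_num), zpow_one, mul_neg_one]

theorem cubeInner_stagger {d : ℕ} (r : ℕ) (k : Site d) (u v : Site d → ℂ) :
    cubeInner r k (fun n => stagger n * u n) (fun n => stagger n * v n) = cubeInner r k u v := by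
  refine Finset.sum_congr rfl fun x _ => ?_
  rw [map_mul, mul_mul_mul_comm, conj_stagger_mul, one_mul]

/-- If all the `P_k` act as scalars on an orthonormal pair in an eigenspace, then the energy is not
close to the edges. -/
theorem energy_bounds_of_scalar {d r : ℕ} (hr : 1 ≤ r) {ω : Config d} {E : ℝ} {u v : Hilb d}
    (hu : u ∈ energySpace r ω E) (hv : v ∈ energySpace r ω E) (hu1 : ‖u‖ = 1) (hv1 : ‖v‖ = 1)
    (h0 : ∀ k, cubeInner r k u v = 0) (h1 : ∀ k, cubeInner r k u u = cubeInner r k v v) :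
    gammaInfty r ≤ E ∧ E ≤ 4 * d + 1 - gammaInfty r := by
  have hus := hasSum_norm_sq u
  rw [hu1, one_pow] at hus
  constructor
  · have hk : ∀ f : Hilb d, HasSum (fun n => ∑ i, ‖f (n + Pi.single i 1) - f n‖ ^ 2)
        (∑ i : Fin d, ‖translation (Pi.single i 1) f - f‖ ^ 2) := fun f =>
      hasSum_sum fun i _ => hasSum_norm_sq (translation (Pi.single i 1) f - f)
    have h := kinetic_pair hr hus (hk u) (hk v) h0 h1
    have h2 := kinetic_lower_edge hr hu
    have h3 := kinetic_lower_edge hr hv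
    rw [hu1] at h2
    rw [hv1] at h3
    linarith
  -- The staggered sign turns sums across a bond into differences and leaves every `cubeInner`
  -- unchanged, so the upper edge reduces to the same kinetic bound.
  · have hk : ∀ f : Hilb d, HasSum (fun n => ∑ i, ‖stagger (n + Pi.single i 1) *
        f (n + Pi.single i 1) - stagger n * f n‖ ^ 2)
        (∑ i : Fin d, ‖translation (Pi.single i 1) f + f‖ ^ 2) := fun f => by
      refine hasSum_sum fun i _ => ?_
      convert hasSum_norm_sq (translation (Pi.single i 1) f + f) using 2 with n
      rw [stagger_add_single, neg_mul, ← neg_add', ← mul_add, norm_neg, norm_mul, norm_stagger,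
        one_mul]
      rfl
    have hus' : HasSum (fun n => ‖stagger n * u n‖ ^ 2) 1 := by
      simpa only [norm_mul, norm_stagger, one_mul] using hus
    have h := kinetic_pair (u := fun n => stagger n * u n) (v := fun n => stagger n * v n)
      hr hus' (hk u) (hk v) (fun k => by rw [cubeInner_stagger]; exact h0 k)
      (fun k => by rw [cubeInner_stagger, cubeInner_stagger]; exact h1 k)
    have h2 := kinetic_upper_edge hr hu
    have h3 := kinetic_upper_edge hr hv
    rw [hu1] at h2
    rw [hv1] at h3
    linarith

/-! ### Varying a single coupling constant -/

open Filter Topology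

/-- A family indexed by `T` in a second countable space, none of whose members is an accumulation
point of the others, is countable. -/
theorem countable_of_forall_comap_nhds_eq_bot {T Y : Type*} [TopologicalSpace Y]
    [SecondCountableTopology Y] (F : T → Y)
    (h : ∀ t, comap F (𝓝 (F t)) ⊓ 𝓟 {t}ᶜ = ⊥) : Countable T := by
  -- In the topology induced by `F` the hypothesis says that no point is a limit of others; a
  -- discrete second countable space is countable.
  let : TopologicalSpace T := TopologicalSpace.induced F inferInstance
  have : SecondCountableTopology T := TopologicalSpace.secondCountableTopology_induced T Y F
  have : DiscreteTopology T := by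
    rw [discreteTopology_iff_nhds_ne]
    intro t
    rw [nhdsWithin, nhds_induced]
    exact h t
  exact TopologicalSpace.separableSpace_iff_countable.mp inferInstance

/-- First order perturbation theory in the coupling constant `ω_k`. -/
theorem coupling_identity {d r : ℕ} (hr : 1 ≤ r) {ω ω' : Config d} {k : Site d}
    (hω : ∀ j, j ≠ k → ω j = ω' j) {E E' : ℝ} {f f' : Hilb d}
    (hf : f ∈ energySpace r ω E) (hf' : f' ∈ energySpace r ω' E') :
    (((ω k : ℝ) : ℂ) - ((ω' k : ℝ) : ℂ)) * cubeInner r k f' f = ((E : ℂ) - E') * inner ℂ f' f := by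
  have h : anderson r ω f = (E : ℂ) • f := Module.End.mem_eigenspace_iff.mp hf
  have h' : anderson r ω' f' = (E' : ℂ) • f' := Module.End.mem_eigenspace_iff.mp hf'
  have hsym : inner ℂ f' (anderson r ω' f) = (E' : ℂ) * inner ℂ f' f := by
    have h1 : inner ℂ (anderson r ω' f') f = inner ℂ f' (anderson r ω' f) :=
      anderson_isSymmetric r ω' f' f
    rw [← h1, h', inner_smul_left, Complex.conj_ofReal]
  have e1 : inner ℂ f' (potentialOp r ω f - potentialOp r ω' f) =
      ((E : ℂ) - E') * inner ℂ f' f := by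
    have : potentialOp r ω f - potentialOp r ω' f = anderson r ω f - anderson r ω' f := by
      simp [anderson]
    rw [this, inner_sub_right, hsym, h, inner_smul_right, sub_mul]
  rw [← e1]
  generalize hg : potentialOp r ω f - potentialOp r ω' f = g
  have hgn : ∀ n, g n = ((potential r ω n : ℝ) : ℂ) * f n - ((potential r ω' n : ℝ) : ℂ) * f n :=
    fun n => by
      rw [← hg, lp.coeFn_sub, Pi.sub_apply, potentialOp_apply, potentialOp_apply]
  have h0 : HasSum (fun n => inner ℂ (f' n) (g n)) (inner ℂ f' g) := lp.hasSum_inner f' g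
  have h1 := hasSum_cubes hr h0
  refine (h1.unique ?_).symm
  -- The two potentials differ only on the cube labelled `k`, by the constant `ω k - ω' k`.
  convert hasSum_single k ?_ using 1
  · rw [cubeInner, Finset.mul_sum]
    refine Finset.sum_congr rfl fun x _ => ?_
    rw [hgn, potential_cubeSite, potential_cubeSite, RCLike.inner_apply]
    ring
  · intro j hj
    refine Finset.sum_eq_zero fun x _ => ?_
    rw [hgn, potential_cubeSite, potential_cubeSite, hω j hj, sub_self, inner_zero_right]

/-! ### Compactness of dominated eigenfunction pairs -/

/-- The functions on `ℤ^d` dominated by `a`. -/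
def dominated {d : ℕ} (a : Site d → ℝ) : Set (Site d → ℂ) :=
  Set.univ.pi fun n => Metric.closedBall 0 (a n)

theorem isCompact_dominated {d : ℕ} (a : Site d → ℝ) : IsCompact (dominated a) :=
  isCompact_univ_pi fun n => isCompact_closedBall 0 (a n)

theorem norm_le_of_mem_dominated {d : ℕ} {a : Site d → ℝ} {u : Site d → ℂ} (hu : u ∈ dominated a)
    (n : Site d) : ‖u n‖ ≤ a n := by
  simpa using hu n (Set.mem_univ n)

theorem exists_hilb_of_mem_dominated {d : ℕ} {a : Site d → ℝ} (ha : Summable fun n => a n ^ 2)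
    {u : Site d → ℂ} (hu : u ∈ dominated a) : ∃ f : Hilb d, ⇑f = u := by
  have : Memℓp u 2 := by
    refine memℓp_gen ?_
    refine Summable.of_nonneg_of_le (fun n => by positivity) (fun n => ?_) ha
    simpa using pow_le_pow_left₀ (norm_nonneg _) (norm_le_of_mem_dominated hu n) 2
  exact ⟨⟨u, this⟩, rfl⟩

/-- The inner product of `ℓ²(ℤ^d)` as a function of the coordinates. -/
def coordInner {d : ℕ} (u v : Site d → ℂ) : ℂ := ∑' n, (starRingEnd ℂ) (u n) * v n

theorem coordInner_coe {d : ℕ} (f g : Hilb d) : coordInner (f : Site d → ℂ) g = inner ℂ f g := by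
  rw [lp.inner_eq_tsum, coordInner]
  exact tsum_congr fun n => by rw [RCLike.inner_apply, mul_comm]

/-- Coordinatewise convergence suffices under a square summable bound, by dominated convergence.
This is what lets the product topology be used throughout. -/
theorem continuousOn_coordInner {d : ℕ} {a : Site d → ℝ} (ha : Summable fun n => a n ^ 2) :
    ContinuousOn (fun p : (Site d → ℂ) × (Site d → ℂ) => coordInner p.1 p.2)
      (dominated a ×ˢ dominated a) := by
  refine continuousOn_tsum (fun n => Continuous.continuousOn ?_) ha ?_
  · exact (Complex.continuous_conj.comp ((continuous_apply n).comp continuous_fst)).mul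
      ((continuous_apply n).comp continuous_snd)
  · rintro n ⟨u, v⟩ ⟨hu, hv⟩
    have h1 := norm_le_of_mem_dominated hu n
    rw [norm_mul, RCLike.norm_conj, sq]
    exact mul_le_mul h1 (norm_le_of_mem_dominated hv n) (norm_nonneg _) ((norm_nonneg _).trans h1)

theorem continuous_cubeInner {d : ℕ} (r : ℕ) (k : Site d) :
    Continuous fun p : (Site d → ℂ) × (Site d → ℂ) => cubeInner r k p.1 p.2 := by
  refine continuous_finsetSum _ fun x _ => ?_
  exact (Complex.continuous_conj.comp ((continuous_apply _).comp continuous_fst)).mul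
      ((continuous_apply _).comp continuous_snd)

theorem continuous_potential {d r : ℕ} (hr : 1 ≤ r) (n : Site d) :
    Continuous fun ω : Config d => potential r ω n := by
  obtain ⟨⟨k, x⟩, rfl⟩ := (cubeSite_bijective hr).2 n
  simp only [potential_cubeSite]
  exact continuous_subtype_val.comp (continuous_apply k)

/-- The eigenvalue equation in coordinates: the value of `(H_ω - E) u` at `n`. -/
def eigenDefect {d : ℕ} (r : ℕ) (ω : Config d) (E : ℝ) (u : Site d → ℂ) (n : Site d) : ℂ :=
  2 * (d : ℂ) * u n - ∑ i : Fin d, (u (n + Pi.single i 1) + u (n - Pi.single i 1))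
    + (potential r ω n : ℂ) * u n - E * u n

theorem mem_energySpace_iff {d r : ℕ} {ω : Config d} {E : ℝ} {f : Hilb d} :
    f ∈ energySpace r ω E ↔ ∀ n, eigenDefect r ω E f n = 0 := by
  rw [energySpace, Module.End.mem_eigenspace_iff, ContinuousLinearMap.coe_coe]
  constructor
  · intro h n
    rw [eigenDefect, ← anderson_apply, h, lp.coeFn_smul, Pi.smul_apply, smul_eq_mul, sub_self]
  · intro h
    ext n
    rw [lp.coeFn_smul, Pi.smul_apply, smul_eq_mul, ← sub_eq_zero, anderson_apply]
    exact h n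

theorem continuous_eigenDefect {d r : ℕ} (hr : 1 ≤ r) (n : Site d) :
    Continuous fun p : Config d × ℝ × (Site d → ℂ) => eigenDefect r p.1 p.2.1 p.2.2 n := by
  have hu : ∀ m : Site d, Continuous fun p : Config d × ℝ × (Site d → ℂ) => p.2.2 m := fun m =>
    (continuous_apply m).comp (continuous_snd.comp continuous_snd)
  have hp : Continuous fun p : Config d × ℝ × (Site d → ℂ) => ((potential r p.1 n : ℝ) : ℂ) :=
    Complex.continuous_ofReal.comp ((continuous_potential hr n).comp continuous_fst)
  have hE : Continuous fun p : Config d × ℝ × (Site d → ℂ) => ((p.2.1 : ℝ) : ℂ) :=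
    Complex.continuous_ofReal.comp (continuous_fst.comp continuous_snd)
  exact (((continuous_const.mul (hu n)).sub (continuous_finsetSum _ fun i _ =>
    (hu _).add (hu _))).add (hp.mul (hu n))).sub (hE.mul (hu n))

/-- A measure of the failure of `P_k` to act as a scalar on the pair `u, v`. -/
def scalarDefect {d : ℕ} (r : ℕ) (k : Site d) (u v : Site d → ℂ) : ℝ :=
  ‖cubeInner r k u v‖ + ‖cubeInner r k u u - cubeInner r k v v‖

theorem continuous_scalarDefect {d : ℕ} (r : ℕ) (k : Site d) :
    Continuous fun p : (Site d → ℂ) × (Site d → ℂ) => scalarDefect r k p.1 p.2 := by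
  have h := continuous_cubeInner (d := d) r k
  exact h.norm.add ((h.comp (continuous_fst.prodMk continuous_fst)).sub
    (h.comp (continuous_snd.prodMk continuous_snd))).norm

/-- Configurations, energies and orthonormal pairs of eigenfunctions dominated by `a` on which
`P_k` is not a scalar, up to `ε`. -/
def nonscalarPairs {d : ℕ} (r : ℕ) (k : Site d) (I : Set ℝ) (a : Site d → ℝ) (ε : ℝ) :
    Set (Config d × ℝ × (Site d → ℂ) × (Site d → ℂ)) :=
  {p | (p.2.1 ∈ I ∧ p.2.2 ∈ dominated a ×ˢ dominated a) ∧
    (coordInner p.2.2.1 p.2.2.1 = 1 ∧ coordInner p.2.2.2 p.2.2.2 = 1 ∧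
      coordInner p.2.2.1 p.2.2.2 = 0) ∧
    (∀ n, eigenDefect r p.1 p.2.1 p.2.2.1 n = 0) ∧ (∀ n, eigenDefect r p.1 p.2.1 p.2.2.2 n = 0) ∧
    ε ≤ scalarDefect r k p.2.2.1 p.2.2.2}

/-- Needed for measurability: the projection to configurations is again compact. The threshold `ε`
replaces the condition of positive defect, which is not closed. -/
theorem isCompact_nonscalarPairs {d r : ℕ} (hr : 1 ≤ r) (k : Site d) {I : Set ℝ}
    (hI : IsCompact I) {a : Site d → ℝ} (ha : Summable fun n => a n ^ 2) (ε : ℝ) :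
    IsCompact (nonscalarPairs r k I a ε) := by
  set D : Set (Config d × ℝ × (Site d → ℂ) × (Site d → ℂ)) :=
    Set.univ ×ˢ I ×ˢ (dominated a ×ˢ dominated a)
  have hD : IsCompact D :=
    isCompact_univ.prod (hI.prod ((isCompact_dominated a).prod (isCompact_dominated a)))
  set G : Config d × ℝ × (Site d → ℂ) × (Site d → ℂ) → ℂ × ℂ × ℂ := fun p =>
    (coordInner p.2.2.1 p.2.2.1, coordInner p.2.2.2 p.2.2.2, coordInner p.2.2.1 p.2.2.2)
  have hc := continuousOn_coordInner ha
  have hG : ContinuousOn G D := by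
    refine ContinuousOn.prodMk ?_ (ContinuousOn.prodMk ?_ ?_)
    · exact hc.comp (f := fun p : Config d × ℝ × (Site d → ℂ) × (Site d → ℂ) =>
        (p.2.2.1, p.2.2.1)) (by fun_prop) fun p hp => ⟨hp.2.2.1, hp.2.2.1⟩
    · exact hc.comp (f := fun p : Config d × ℝ × (Site d → ℂ) × (Site d → ℂ) =>
        (p.2.2.2, p.2.2.2)) (by fun_prop) fun p hp => ⟨hp.2.2.2, hp.2.2.2⟩
    · exact hc.comp (f := fun p : Config d × ℝ × (Site d → ℂ) × (Site d → ℂ) => p.2.2)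
        (by fun_prop) fun p hp => hp.2.2
  have h1 : IsClosed (D ∩ G ⁻¹' {(1, 1, 0)}) :=
    hG.preimage_isClosed_of_isClosed hD.isClosed isClosed_singleton
  have h2 : IsClosed {p : Config d × ℝ × (Site d → ℂ) × (Site d → ℂ) |
      ∀ n, eigenDefect r p.1 p.2.1 p.2.2.1 n = 0} := by
    simp only [Set.ofPred_forall]
    exact isClosed_iInter fun n => isClosed_eq ((continuous_eigenDefect hr n).comp
      (f := fun p : Config d × ℝ × (Site d → ℂ) × (Site d → ℂ) => (p.1, p.2.1, p.2.2.1))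
      (by fun_prop)) continuous_const
  have h3 : IsClosed {p : Config d × ℝ × (Site d → ℂ) × (Site d → ℂ) |
      ∀ n, eigenDefect r p.1 p.2.1 p.2.2.2 n = 0} := by
    simp only [Set.ofPred_forall]
    exact isClosed_iInter fun n => isClosed_eq ((continuous_eigenDefect hr n).comp
      (f := fun p : Config d × ℝ × (Site d → ℂ) × (Site d → ℂ) => (p.1, p.2.1, p.2.2.2))
      (by fun_prop)) continuous_const
  have h4 : IsClosed {p : Config d × ℝ × (Site d → ℂ) × (Site d → ℂ) |
      ε ≤ scalarDefect r k p.2.2.1 p.2.2.2} :=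
    isClosed_le continuous_const ((continuous_scalarDefect r k).comp
      (continuous_snd.comp continuous_snd))
  have h5 := hD.of_isClosed_subset (((h1.inter h2).inter h3).inter h4) fun p hp => hp.1.1.1.1
  convert h5 using 1
  ext p
  simp only [nonscalarPairs, D, G, Set.mem_inter_iff, Set.mem_ofPred_eq, Set.mem_prod, Set.mem_univ,
    true_and, Set.mem_preimage, Set.mem_singleton_iff, Prod.mk.injEq]
  tauto

theorem exists_pair_of_mem_image {d r : ℕ} {k : Site d} {I : Set ℝ}
    {a : Site d → ℝ} (ha : Summable fun n => a n ^ 2) {ε : ℝ} (hε : 0 < ε) {ω : Config d}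
    (h : ω ∈ Prod.fst '' nonscalarPairs r k I a ε) :
    ∃ p : ℝ × Hilb d × Hilb d, ((p.2.1 : Site d → ℂ) ∈ dominated a ∧
      (p.2.2 : Site d → ℂ) ∈ dominated a) ∧ (p.2.1 ∈ energySpace r ω p.1 ∧
      p.2.2 ∈ energySpace r ω p.1) ∧ (inner ℂ p.2.1 p.2.1 = (1 : ℂ) ∧
      inner ℂ p.2.2 p.2.2 = (1 : ℂ) ∧ inner ℂ p.2.1 p.2.2 = (0 : ℂ)) ∧
      0 < scalarDefect r k p.2.1 p.2.2 := by
  obtain ⟨⟨ω', E, u, v⟩, ⟨⟨_, hu, hv⟩, ⟨h1, h2, h3⟩, hEu, hEv, hs⟩, hω⟩ := h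
  change ω' = ω at hω
  subst hω
  dsimp only at hu hv h1 h2 h3 hEu hEv hs
  obtain ⟨u, rfl⟩ := exists_hilb_of_mem_dominated ha hu
  obtain ⟨v, rfl⟩ := exists_hilb_of_mem_dominated ha hv
  rw [coordInner_coe] at h1 h2 h3
  exact ⟨(E, u, v), ⟨hu, hv⟩, ⟨mem_energySpace_iff.mpr hEu, mem_energySpace_iff.mpr hEv⟩,
    ⟨h1, h2, h3⟩, hε.trans_le hs⟩

/-! ### Countability of the exceptional couplings -/

theorem tendsto_cubeInner {d : ℕ} (r : ℕ) (k : Site d) {T : Type*} {l : Filter T}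
    {w : T → Site d → ℂ} {w₀ : Site d → ℂ} (x : Site d → ℂ) (h : Tendsto w l (𝓝 w₀)) :
    Tendsto (fun y => cubeInner r k (w y) x) l (𝓝 (cubeInner r k w₀ x)) := by
  have hc : Continuous fun w : Site d → ℂ => cubeInner r k w x :=
    (continuous_cubeInner r k).comp (continuous_id.prodMk continuous_const)
  exact (hc.tendsto w₀).comp h

theorem tendsto_inner_of_dominated {d : ℕ} {a : Site d → ℝ} (ha : Summable fun n => a n ^ 2)
    {T : Type*} {l : Filter T} {w : T → Hilb d} {w₀ x : Hilb d}
    (h : Tendsto (fun y => (w y : Site d → ℂ)) l (𝓝 (w₀ : Site d → ℂ)))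
    (hw : ∀ y, (w y : Site d → ℂ) ∈ dominated a) (hw₀ : (w₀ : Site d → ℂ) ∈ dominated a)
    (hx : (x : Site d → ℂ) ∈ dominated a) :
    Tendsto (fun y => inner ℂ (w y) x) l (𝓝 (inner ℂ w₀ x)) := by
  have h0 : Tendsto (fun y => ((w y : Site d → ℂ), (x : Site d → ℂ))) l
      (𝓝 ((w₀ : Site d → ℂ), (x : Site d → ℂ))) := h.prodMk_nhds tendsto_const_nhds
  have h1 := (continuousOn_coordInner ha) ((w₀ : Site d → ℂ), (x : Site d → ℂ)) ⟨hw₀, hx⟩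
  have h2 := h1.tendsto.comp (tendsto_nhdsWithin_iff.mpr
    ⟨h0, Eventually.of_forall fun y => ⟨hw y, hx⟩⟩)
  simpa only [Function.comp_def, coordInner_coe] using h2

/-- A family of couplings `ω_k` at which `P_k` is not a scalar on a pair of eigenfunctions is
countable. -/
theorem countable_of_scalarDefect_pos {d r : ℕ} (hr : 1 ≤ r) (k : Site d)
    {a : Site d → ℝ} (ha : Summable fun n => a n ^ 2) (ω : Config d) {T : Type*}
    {τ : T → unitInterval} (hτ : Function.Injective τ)
    (E : T → ℝ) (u v : T → Hilb d)
    (hdom : ∀ t, (u t : Site d → ℂ) ∈ dominated a ∧ (v t : Site d → ℂ) ∈ dominated a)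
    (hspace : ∀ t : T, u t ∈ energySpace r (Function.update ω k (τ t)) (E t) ∧
      v t ∈ energySpace r (Function.update ω k (τ t)) (E t))
    (hinner : ∀ t, inner ℂ (u t) (u t) = (1 : ℂ) ∧ inner ℂ (v t) (v t) = (1 : ℂ) ∧
      inner ℂ (u t) (v t) = (0 : ℂ))
    (hdef : ∀ t, 0 < scalarDefect r k (u t) (v t)) : Countable T := by
  refine countable_of_forall_comap_nhds_eq_bot
    (fun t : T => ((u t : Site d → ℂ), (v t : Site d → ℂ))) fun t => ?_
  by_contra hne
  -- The filter of indices `y ≠ t` whose pairs approach the pair at `t`.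
  set l := comap (fun t : T => ((u t : Site d → ℂ), (v t : Site d → ℂ)))
    (𝓝 ((u t : Site d → ℂ), (v t : Site d → ℂ))) ⊓ 𝓟 {t}ᶜ
  have : NeBot l := ⟨hne⟩
  have hl : Tendsto (fun t : T => ((u t : Site d → ℂ), (v t : Site d → ℂ))) l
    (𝓝 ((u t : Site d → ℂ), (v t : Site d → ℂ))) := tendsto_comap.mono_left inf_le_left
  have hu : Tendsto (fun t : T => (u t : Site d → ℂ)) l (𝓝 (u t : Site d → ℂ)) :=
    (continuous_fst.tendsto _).comp hl
  have hv : Tendsto (fun t : T => (v t : Site d → ℂ)) l (𝓝 (v t : Site d → ℂ)) :=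
    (continuous_snd.tendsto _).comp hl
  have hne' : ∀ᶠ y : T in l, y ≠ t := by
    filter_upwards [mem_inf_of_right (mem_principal_self _)] with y hy using hy
  -- The difference quotient of the energy in `ω_k`. Its denominator is nonzero along `l`, as `τ` is
  -- injective.
  set ρ : T → ℂ := fun y => ((E t : ℂ) - E y) /
    (((τ t : ℝ) : ℂ) - ((τ y : ℝ) : ℂ))
  have hid : ∀ᶠ y in l, ∀ (x w : Hilb d), x ∈ energySpace r (Function.update ω k (τ t)) (E t) →
      w ∈ energySpace r (Function.update ω k (τ y)) (E y) →
      cubeInner r k w x = ρ y * inner ℂ w x := by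
    filter_upwards [hne'] with y hy x w hx hw
    have h := coupling_identity hr (k := k) (ω := Function.update ω k (τ t))
      (ω' := Function.update ω k (τ y)) (fun j hj => by simp [hj]) hx hw
    rw [Function.update_self, Function.update_self] at h
    have h0 : (((τ t : ℝ) : ℂ) - ((τ y : ℝ) : ℂ)) ≠ 0 := by
      rw [sub_ne_zero]
      intro h
      exact hy (hτ (Subtype.ext (Complex.ofReal_injective h))).symm
    simp only [ρ]
    rw [div_mul_eq_mul_div, ← h, mul_div_cancel_left₀ _ h0]
  -- The same quotient `ρ` serves `u` and `v`, since both belong to the same energy; uniqueness of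
  -- its limit will equate the two diagonal entries.
  have lim_rho : ∀ {w : T → Hilb d}, (∀ y, w y ∈ energySpace r (Function.update ω k (τ y)) (E y)) →
      (∀ y, (w y : Site d → ℂ) ∈ dominated a) → inner ℂ (w t) (w t) = 1 →
      Tendsto (fun y => (w y : Site d → ℂ)) l (𝓝 (w t : Site d → ℂ)) →
      Tendsto ρ l (𝓝 (cubeInner r k (w t) (w t))) := by
    intro w hw hwd h1 hlim
    have h2 := tendsto_inner_of_dominated ha hlim hwd (hwd t) (hwd t)
    rw [h1] at h2
    have h3 := (tendsto_cubeInner r k (w t : Site d → ℂ) hlim).div h2 one_ne_zero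
    rw [div_one] at h3
    refine h3.congr' ?_
    filter_upwards [hid, h2.eventually_ne one_ne_zero] with y hy hy0
    rw [Pi.div_apply, hy (w t) (w y) (hw t) (hw y), mul_div_cancel_right₀ _ hy0]
  have hρu := lim_rho (w := u) (fun y => (hspace y).1) (fun y => (hdom y).1) (hinner t).1 hu
  have hρv := lim_rho (w := v) (fun y => (hspace y).2) (fun y => (hdom y).2) (hinner t).2.1 hv
  have huv := tendsto_inner_of_dominated ha hu (fun y => (hdom y).1) (hdom t).1 (hdom t).2
  rw [(hinner t).2.2] at huv
  have hzero : cubeInner r k (u t) (v t) = 0 := by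
    have h1 := hρu.mul huv
    rw [mul_zero] at h1
    refine tendsto_nhds_unique (tendsto_cubeInner r k (v t : Site d → ℂ) hu) (h1.congr' ?_)
    filter_upwards [hid] with y hy
    exact (hy (v t) (u y) (hspace t).2 (hspace y).1).symm
  have := hdef t
  rw [scalarDefect, hzero, tendsto_nhds_unique hρu hρv] at this
  simp at this

/-- With all other coupling constants fixed, `P_k` acts as a scalar on the eigenspaces for all but
countably many values of `ω_k`. -/
theorem countable_nonscalar {d r : ℕ} (hr : 1 ≤ r) (k : Site d) (I : Set ℝ)
    {a : Site d → ℝ} (ha : Summable fun n => a n ^ 2) {ε : ℝ} (hε : 0 < ε) (ω : Config d) :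
    {t : unitInterval | Function.update ω k t ∈
      Prod.fst '' nonscalarPairs r k I a ε}.Countable := by
  choose p hdom hspace hinner hdef using
    fun t : {t : unitInterval | Function.update ω k t ∈ Prod.fst '' nonscalarPairs r k I a ε} =>
      exists_pair_of_mem_image ha hε t.2
  exact Set.countable_coe_iff.mp <| countable_of_scalarDefect_pos hr k ha ω
    Subtype.val_injective (fun t => (p t).1) (fun t => (p t).2.1)
    (fun t => (p t).2.2) hdom hspace hinner hdef

/-! ### Exponential weights -/

theorem summable_pi_prod {α : Type*} {f : α → ℝ} (hf0 : ∀ x, 0 ≤ f x) (hf : Summable f) :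
    ∀ d : ℕ, Summable fun n : Fin d → α => ∏ i, f (n i) := by
  intro d
  induction d with
  | zero => exact Summable.of_finite
  | succ d ih =>
    rw [← (Fin.consEquiv (fun _ => α)).summable_iff]
    have h := hf.mul_of_nonneg ih hf0 fun n => Finset.prod_nonneg fun i _ => hf0 _
    refine h.congr fun p => ?_
    simp [Fin.prod_univ_succ, Fin.consEquiv]

theorem summable_exp_neg_norm {d : ℕ} {c : ℝ} (hc : 0 < c) :
    Summable fun n : Site d => Real.exp (-c * ‖n‖) := by
  -- The sup norm is at least the average of the coordinate sizes, so the exponential is bounded by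
  -- a product over coordinates; `d + 1` keeps `b` defined at `d = 0`.
  set b : ℝ := c / (d + 1) with hb
  have hb0 : 0 < b := by positivity
  have h1 : Summable fun z : ℤ => Real.exp (-b * |(z : ℝ)|) := by
    have h : Summable fun n : ℕ => Real.exp (-b * n) := by
      have := Real.summable_exp_nat_mul_iff.mpr (neg_lt_zero.mpr hb0)
      exact this.congr fun n => by rw [mul_comm]
    refine Summable.of_nat_of_neg (h.congr fun n => ?_) (h.congr fun n => ?_) <;> simp
  refine Summable.of_nonneg_of_le (fun n => (Real.exp_pos _).le) (fun n => ?_)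
    (summable_pi_prod (fun z => (Real.exp_pos _).le) h1 d)
  rw [← Real.exp_sum, Real.exp_le_exp, ← Finset.mul_sum, neg_mul, neg_mul, neg_le_neg_iff]
  have h2 : ∑ i, |((n i : ℤ) : ℝ)| ≤ d * ‖n‖ := by
    have : ∑ i, |((n i : ℤ) : ℝ)| ≤ ∑ _i : Fin d, ‖n‖ := Finset.sum_le_sum fun i _ => by
      simpa [Int.norm_eq_abs] using norm_le_pi_norm n i
    simpa using this
  calc b * ∑ i, |((n i : ℤ) : ℝ)| ≤ b * (d * ‖n‖) := by gcongr
    _ = c * (d / (d + 1) * ‖n‖) := by rw [hb]; ring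
    _ ≤ c * (1 * ‖n‖) := by
        gcongr
        rw [div_le_one (by positivity)]; linarith
    _ = c * ‖n‖ := by ring

/-- A countable cofinal family of exponentially decaying weights. -/
def expWeight {d : ℕ} (j : ℕ) (n : Site d) : ℝ := (j + 1) * Real.exp (-(1 / (j + 1)) * ‖n‖)

theorem summable_expWeight_sq {d : ℕ} (j : ℕ) : Summable fun n : Site d => expWeight j n ^ 2 := by
  have h := (summable_exp_neg_norm (d := d) (c := 2 * (1 / (j + 1))) (by positivity)).mul_left
    (((j : ℝ) + 1) ^ 2)
  refine h.congr fun n => ?_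
  rw [expWeight, mul_pow, ← Real.exp_nat_mul]
  congr 2
  push_cast
  ring

/-- Holding for all large `j` allows two eigenfunctions to share one weight. -/
theorem ExpDecay.exists_dominated {d : ℕ} {f : Hilb d} (hf : ExpDecay f) :
    ∃ j₀ : ℕ, ∀ j ≥ j₀, (f : Site d → ℂ) ∈ dominated (expWeight j) := by
  obtain ⟨C, c, hc, h⟩ := hf
  obtain ⟨j₁, hj₁⟩ := exists_nat_ge C
  obtain ⟨j₂, hj₂⟩ := exists_nat_one_div_lt hc
  refine ⟨max j₁ j₂, fun j hj n _ => ?_⟩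
  have h1 : C ≤ j + 1 := by
    have : (j₁ : ℝ) ≤ j := by exact_mod_cast (le_max_left _ _).trans hj
    linarith
  have h2 : 1 / ((j : ℝ) + 1) ≤ c := by
    have : (j₂ : ℝ) ≤ j := by exact_mod_cast (le_max_right _ _).trans hj
    exact (one_div_le_one_div_of_le (by positivity) (by linarith)).trans hj₂.le
  rw [mem_closedBall_zero_iff]
  refine (h n).trans ?_
  rw [expWeight]
  refine mul_le_mul h1 (Real.exp_le_exp.mpr ?_) (Real.exp_pos _).le (by positivity)
  exact mul_le_mul_of_nonneg_right (neg_le_neg h2) (norm_nonneg _)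

/-! ### Null sets by Fubini in one coordinate -/

section Probability

variable {Ω : Type*} [MeasurableSpace Ω] {P : Measure Ω}

theorem indepFun_update {ι β : Type*} [DecidableEq ι] [MeasurableSpace β] {ω : ι → Ω → β}
    (hm : ∀ k, Measurable (ω k)) (hi : iIndepFun ω P) (k : ι) (b : β) :
    IndepFun (fun a => Function.update (fun j => ω j a) k b) (ω k) P := by
  have h := indep_iSup_of_disjoint (m := fun j => MeasurableSpace.comap (ω j) inferInstance)
    (fun j => (hm j).comap_le) hi (S := {k}ᶜ) (T := {k}) disjoint_compl_left
  rw [IndepFun_iff_Indep]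
  refine indep_of_indep_of_le_right (indep_of_indep_of_le_left h ?_) ?_
  · rw [← measurable_iff_comap_le]
    refine @measurable_pi_lambda _ _ _ (_) _ _ fun j => ?_
    by_cases hj : j = k
    · subst hj; simp
    · simp only [Function.update_of_ne hj]
      rw [measurable_iff_comap_le]
      exact le_iSup₂_of_le j hj le_rfl
  · exact le_iSup₂_of_le k rfl le_rfl

/-- A measurable set of configurations is null if its sections in one coordinate are countable. -/
theorem ae_notMem_of_countable_sections {ι β : Type*} [DecidableEq ι] [MeasurableSpace β]
    [MeasurableSingletonClass β] [IsProbabilityMeasure P] {ω : ι → Ω → β}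
    (hm : ∀ k, Measurable (ω k)) (hi : iIndepFun ω P) (k : ι) [NullSingletonClass (P.map (ω k))]
    {B : Set (ι → β)} (hB : MeasurableSet B)
    (hc : ∀ w : ι → β, {t | Function.update w k t ∈ B}.Countable) :
    ∀ᵐ a ∂P, (fun j => ω j a) ∉ B := by
  have : Nonempty Ω := P.nonempty_of_neZero
  obtain ⟨a₀⟩ := this
  -- Freezing coordinate `k` makes `Y` independent of `ω k`; the frozen value is immaterial, since
  -- it is overwritten afterwards.
  set Y : Ω → ι → β := fun a => Function.update (fun j => ω j a) k (ω k a₀)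
  have hY : Measurable Y := by
    refine measurable_pi_lambda _ fun j => ?_
    by_cases hj : j = k
    · subst hj; simp [Y]
    · simpa [Y, Function.update_of_ne hj] using hm j
  have hind : IndepFun Y (ω k) P := indepFun_update hm hi k (ω k a₀)
  have hlaw := (indepFun_iff_map_prod_eq_prod_map_map hY.aemeasurable (hm k).aemeasurable).mp hind
  have hG : Measurable fun p : (ι → β) × β => Function.update p.1 k p.2 := measurable_update'
  have h0 : (P.map fun a => (Y a, ω k a)) ((fun p : (ι → β) × β => Function.update p.1 k p.2) ⁻¹' B)
      = 0 := by
    rw [hlaw, Measure.measure_prod_null (hG hB)]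
    exact Eventually.of_forall fun w => (hc w).measure_zero _
  rw [Measure.map_apply (hY.prodMk (hm k)) (hG hB)] at h0
  rw [ae_iff]
  convert h0 using 2
  ext a
  simp [Y]

end Probability

/-! ### Simplicity near the band edges -/

theorem isCompact_bandEdges (d : ℕ) (E : ℝ) : IsCompact (bandEdges d E) :=
  isCompact_Icc.union isCompact_Icc

theorem bandEdges_mono {d : ℕ} {E E' : ℝ} (h : E ≤ E') : bandEdges d E ⊆ bandEdges d E' :=
  Set.union_subset_union (Set.Icc_subset_Icc_right h) (Set.Icc_subset_Icc_left (by linarith))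

/-- A subspace of positive dimension without orthonormal pairs is one-dimensional. -/
theorem finrank_eq_one_of_no_orthonormal_pair {H : Type*} [NormedAddCommGroup H]
    [InnerProductSpace ℂ H] (V : Submodule ℂ H) (hV : V ≠ ⊥)
    (h : ∀ u ∈ V, ∀ v ∈ V, ‖u‖ = 1 → ‖v‖ = 1 → inner ℂ u v = (0 : ℂ) → False) :
    Module.finrank ℂ V = 1 := by
  obtain ⟨x, hxV, hx⟩ := V.exists_mem_ne_zero_of_ne_bot hV
  have normalize : ∀ y : H, y ≠ 0 → ‖((‖y‖ : ℂ)⁻¹) • y‖ = 1 := fun y hy => norm_smul_inv_norm hy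
  rw [finrank_eq_one_iff']
  set u : H := ((‖x‖ : ℂ)⁻¹) • x with hu
  have huV : u ∈ V := V.smul_mem _ hxV
  have hu1 : ‖u‖ = 1 := normalize x hx
  refine ⟨⟨u, huV⟩, fun h0 => ?_, fun w => ⟨inner ℂ u (w : H), ?_⟩⟩
  · have : u = 0 := congrArg Subtype.val h0
    rw [this, norm_zero] at hu1
    exact zero_ne_one hu1
  · by_contra hne
    set z : H := (w : H) - (inner ℂ u (w : H)) • u with hz
    have hz0 : z ≠ 0 := fun h0 => hne (Subtype.ext (sub_eq_zero.mp h0).symm)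
    have hzV : z ∈ V := V.sub_mem w.2 (V.smul_mem _ huV)
    refine h u huV _ (V.smul_mem ((‖z‖ : ℂ)⁻¹) hzV) hu1 (normalize z hz0) ?_
    rw [inner_smul_right, hz, inner_sub_right, inner_smul_right, inner_self_eq_norm_sq_to_K, hu1]
    simp

/-- Near the band edges, eigenspaces of exponentially decaying eigenfunctions are simple unless the
configuration admits a dominated pair on which some `P_k` is not a scalar. -/
theorem simpleOn_of_forall_notMem {d r : ℕ} (hr : 1 ≤ r) {ω : Config d} {E₀ : ℝ}
    (hE₀ : E₀ < gammaInfty r)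
    (hdec : ∀ E ∈ bandEdges d E₀, ∀ f ∈ energySpace r ω E, ExpDecay f)
    (hω : ∀ (k : Site d) (j m : ℕ), ω ∉ Prod.fst ''
      nonscalarPairs r k (bandEdges d E₀) (expWeight j) (1 / ((m : ℝ) + 1))) :
    SimpleOn r ω (bandEdges d E₀) := by
  intro E hE hev
  refine finrank_eq_one_of_no_orthonormal_pair _ hev fun u hu v hv hu1 hv1 huv => ?_
  obtain ⟨j₁, hj₁⟩ := (hdec E hE u hu).exists_dominated
  obtain ⟨j₂, hj₂⟩ := (hdec E hE v hv).exists_dominated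
  have hself : ∀ f : Hilb d, ‖f‖ = 1 → coordInner (f : Site d → ℂ) f = 1 := fun f hf => by
    rw [coordInner_coe, inner_self_eq_norm_sq_to_K, hf]; simp
  have hdef : ∀ k, scalarDefect r k (u : Site d → ℂ) v ≤ 0 := by
    intro k
    by_contra! hpos
    -- A positive defect exceeds some `1 / (m + 1)`, so countably many thresholds suffice.
    obtain ⟨m, hm⟩ := exists_nat_one_div_lt hpos
    refine hω k (max j₁ j₂) m ⟨(ω, E, u, v), ⟨⟨hE, hj₁ _ (le_max_left _ _),
      hj₂ _ (le_max_right _ _)⟩, ⟨hself u hu1, hself v hv1, ?_⟩, mem_energySpace_iff.mp hu,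
      mem_energySpace_iff.mp hv, hm.le⟩, rfl⟩
    rw [coordInner_coe]; exact huv
  have h0 : ∀ k, cubeInner r k (u : Site d → ℂ) v = 0 := fun k => by
    have h1 := hdef k
    rw [scalarDefect] at h1
    exact norm_le_zero_iff.mp (by linarith [norm_nonneg (cubeInner r k (u : Site d → ℂ) u -
      cubeInner r k (v : Site d → ℂ) v)])
  have h1 : ∀ k, cubeInner r k (u : Site d → ℂ) u = cubeInner r k (v : Site d → ℂ) v := fun k => by
    have h1 := hdef k
    rw [scalarDefect] at h1
    exact sub_eq_zero.mp (norm_le_zero_iff.mp (by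
      linarith [norm_nonneg (cubeInner r k (u : Site d → ℂ) v)]))
  obtain ⟨hlo, hhi⟩ := energy_bounds_of_scalar hr hu hv hu1 hv1 h0 h1
  rcases hE with hE | hE
  · linarith [hE.2]
  · linarith [hE.1]

end HigherRankAnderson
end

open HigherRankAnderson
theorem theorem5p2
    {Ω : Type*} [MeasurableSpace Ω] (P : Measure Ω) [IsProbabilityMeasure P]
    (d r : ℕ) (hd : 1 ≤ d) (hr : 1 ≤ r)
    (ρ : ℝ → ℝ) (K ρmin ρmax : ℝ) (hρmin : 0 < ρmin)
    (hρ_lip : ∀ x ∈ Set.Icc (0 : ℝ) 1, ∀ y ∈ Set.Icc (0 : ℝ) 1, |ρ x - ρ y| ≤ K * |x - y|)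
    (hρ_bounds : ∀ x ∈ Set.Icc (0 : ℝ) 1, ρmin < ρ x ∧ ρ x < ρmax)
    (ω : Site d → Ω → unitInterval)
    (hω_meas : ∀ k, Measurable (ω k))
    (hω_indep : iIndepFun ω P)
    (hω_law : ∀ k, P.map (ω k) =
      (volume : Measure unitInterval).withDensity (fun x => ENNReal.ofReal (ρ x)))
    (Eloc : ℝ)
    (hloc : ∀ᵐ a ∂P, LocalizedOn r (fun k => ω k a) (bandEdges d Eloc))
    (E₀ : ℝ) (hE₀ : 0 < E₀) (hE₀' : E₀ < min (gammaInfty r) Eloc) :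
    ∀ᵐ a ∂P, SimpleOn r (fun k => ω k a) (bandEdges d E₀) := by
  have hvol : NullSingletonClass (volume : Measure unitInterval) :=
    ⟨fun x => by rw [unitInterval.volume_apply, Set.image_singleton, Real.volume_singleton]⟩
  have hatoms : ∀ k, NullSingletonClass (P.map (ω k)) := fun k => by
    rw [hω_law k]; infer_instance
  have hnull : ∀ (k : Site d) (j m : ℕ), ∀ᵐ a ∂P, (fun k => ω k a) ∉ Prod.fst ''
      nonscalarPairs r k (bandEdges d E₀) (expWeight j) (1 / ((m : ℝ) + 1)) := fun k j m => by
    have := hatoms k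
    refine ae_notMem_of_countable_sections hω_meas hω_indep k ?_
      (countable_nonscalar hr k _ (summable_expWeight_sq j) (by positivity))
    -- A continuous image of a compact set is compact, hence closed and measurable.
    exact ((isCompact_nonscalarPairs hr k (isCompact_bandEdges d E₀) (summable_expWeight_sq j)
      _).image continuous_fst).measurableSet
  have hall := ae_all_iff.mpr fun k => ae_all_iff.mpr fun j => ae_all_iff.mpr fun m => hnull k j m
  filter_upwards [hloc, hall] with a hdec hω
  exact simpleOn_of_forall_notMem hr (hE₀'.trans_le (min_le_left _ _))
    (fun E hE f hf => hdec.2 E (bandEdges_mono (hE₀'.le.trans (min_le_right _ _)) hE) f hf) hω
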